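/- Let $\epsilon_{n,i}$, $n,i\ge 0$, be i.i.d. standard Gaussian random variables. For $c>0$ let $H_{c,2}=\{y=(y_0,y_1,\dots)\in\ell_2:\ \sum_{i\ge0}e^{ci}y_i^2<\infty\}$ (with its Borel $\sigma$-algebra), and let $S_c=\{y\in H_{c,2}:\|y\|_2=1\}$. Consider the Markov chain on $S_c$ given by $$Z_{n+1}=\frac{(g_n,Z_n)}{(1+g_n^2)^{1/2}},\qquad g_n=\sum_{i=0}^\infty\epsilon_{n,i}(Z_n)_i,$$ where $(g,y)$ denotes the sequence $(g,y_0,y_1,\dots)$ and $(\epsilon_{n,i})_{i\ge0}$ is independent of $Z_0,\dots,Z_n$. There is $c_0>0$ such that the following holds for every $c>0$. (i) If $c<c_0$, the chain has at least one invariant probability measure on $S_c$. (ii) Let $\mu_v$ be an extremal invariant measure, that is, an extreme point of the convex set of invariant probability measures of the chain on $S_c$. Let $\hat X_0$ have law $\mu_v$ and be independent of $(\epsilon_{n,i})_{n,i\ge0}$, and set $\hat X_{n+1}=\bigl(\sum_{i=0}^\infty\epsilon_{n,i}(\hat X_n)_i,\ \hat X_n\bigr)$ for $n\ge 0$. Then,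 almost surely, all these series converge absolutely, and $$\lim_{n\to\infty}\frac1n\log\|\hat X_n\|_2=\lambda_v\quad\text{a.s.},\qquad \lambda_v=\frac12\int\mu_v(dy)\,\mathbb E_\epsilon\log\Bigl(1+\Bigl(\sum_{i=0}^\infty\epsilon_i y_i\Bigr)^2\Bigr),$$ where $\mathbb E_\epsilon$ is the expectation over a sequence $(\epsilon_i)_{i\ge0}$ of i.i.d. standard Gaussian variables, and the function $\log(1+(\sum_i\epsilon_iy_i)^2)$ is integrable with respect to the product of $\mu_v$ and the law of $(\epsilon_i)_{i\ge0}$. -/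

import Mathlib

open MeasureTheory ProbabilityTheory Filter Topology
open scoped ENNReal

noncomputable section

namespace RandomFibonacci

/-- The `ℓ₂` norm of a real sequence (used only for square-summable sequences). -/
def l2norm (y : ℕ → ℝ) : ℝ := √(∑' i, y i ^ 2)

/-- The weighted space `H_{c,2} = {y ∈ ℓ₂ : ∑ e^{ci} y_i² < ∞}`. -/
def H (c : ℝ) : Set (ℕ → ℝ) :=
  {y | Summable (fun i : ℕ => y i ^ 2) ∧ Summable (fun i : ℕ => Real.exp (c * i) * y i ^ 2)}

/-- The state space of the normalized chain: the vectors of `H_{c,2}` of `ℓ₂` norm one.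
It carries the σ-algebra generated by the coordinates, which is the trace of the Borel σ-algebra of
the separable Hilbert space `H_{c,2}`. -/
abbrev UnitH (c : ℝ) : Type := {y : ℕ → ℝ // y ∈ H c ∧ l2norm y = 1}

/-- The sequence `(g, y) = (g, y₀, y₁, …)`. -/
def prepend (g : ℝ) (y : ℕ → ℝ) : ℕ → ℝ
  | 0 => g
  | i + 1 => y i

/-- The random linear combination `∑ᵢ eᵢ yᵢ`. For `c > 0`, `y ∈ H_{c,2}` and i.i.d. standard
Gaussian `eᵢ`, the series converges absolutely with probability one. -/
def comb (e y : ℕ → ℝ) : ℝ := ∑' i, e i * y i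

/-- One step of the normalized recursion: `y ↦ (g, y) / (1 + g²)^{1/2}` with `g = ∑ᵢ eᵢ yᵢ`. -/
def step (e y : ℕ → ℝ) : ℕ → ℝ :=
  fun i => prepend (comb e y) y i / √(1 + comb e y ^ 2)

theorem summable_prepend_sq {g : ℝ} {y : ℕ → ℝ} (hy : Summable (fun i => y i ^ 2)) :
    Summable (fun i => prepend g y i ^ 2) :=
  (summable_nat_add_iff (f := fun i => prepend g y i ^ 2) 1).1 hy

theorem step_mem {c : ℝ} (e : ℕ → ℝ) (y : UnitH c) :
    step e y.1 ∈ H c ∧ l2norm (step e y.1) = 1 := by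
  obtain ⟨y, ⟨h1, h2⟩, h3⟩ := y
  have hpos : 0 < 1 + comb e y ^ 2 := by positivity
  have hsq : ∀ i, step e y i ^ 2 = prepend (comb e y) y i ^ 2 / (1 + comb e y ^ 2) := by
    intro i
    simp only [step, div_pow, Real.sq_sqrt hpos.le]
  have hs := summable_prepend_sq (g := comb e y) h1
  refine ⟨⟨?_, ?_⟩, ?_⟩
  · simp only [hsq]
    exact hs.div_const _
  · simp only [hsq, ← mul_div_assoc]
    refine Summable.div_const ?_ _
    refine (summable_nat_add_iff
      (f := fun i : ℕ => Real.exp (c * i) * prepend (comb e y) y i ^ 2) 1).1 ?_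
    refine (h2.mul_left (Real.exp c)).congr fun i => Eq.symm ?_
    change Real.exp (c * ((i + 1 : ℕ) : ℝ)) * y i ^ 2 =
      Real.exp c * (Real.exp (c * i) * y i ^ 2)
    rw [← mul_assoc, ← Real.exp_add]
    push_cast
    ring_nf
  · have h4 : ∑' i, y i ^ 2 = 1 := by simpa [l2norm] using h3
    change √(∑' i, step e y i ^ 2) = 1
    simp only [hsq, tsum_div_const]
    rw [hs.tsum_eq_zero_add]
    simp only [prepend, h4]
    rw [add_comm, div_self hpos.ne', Real.sqrt_one]

/-- The step of the normalized recursion as a map of the state space. -/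
def stepU (c : ℝ) (e : ℕ → ℝ) (y : UnitH c) : UnitH c := ⟨step e y.1, step_mem e y⟩

theorem measurable_coord (c : ℝ) (i : ℕ) :
    Measurable (fun p : UnitH c × (ℕ → ℝ) => p.1.1 i) :=
  (measurable_pi_apply i).comp (measurable_subtype_coe.comp measurable_fst)

theorem measurable_comb (c : ℝ) : Measurable (fun p : UnitH c × (ℕ → ℝ) => comb p.2 p.1.1) :=
  Measurable.tsum fun i =>
    ((measurable_pi_apply i).comp measurable_snd).mul (measurable_coord c i)

theorem measurable_stepU (c : ℝ) :
    Measurable (fun p : UnitH c × (ℕ → ℝ) => stepU c p.2 p.1) := by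
  have hc := measurable_comb c
  refine Measurable.subtype_mk (measurable_pi_lambda _ fun i => ?_)
  cases i with
  | zero => exact hc.div (by fun_prop)
  | succ i =>
    exact (measurable_coord c i).div (by fun_prop)

/-- The law of a sequence of i.i.d. standard Gaussian variables. -/
def gaussianSeq : Measure (ℕ → ℝ) := Measure.infinitePi (fun _ : ℕ => gaussianReal 0 1)

instance : IsProbabilityMeasure gaussianSeq := by
  unfold gaussianSeq; infer_instance

/-- The transition kernel of the normalized Markov chain: from `y` it moves to
`(g, y) / (1 + g²)^{1/2}`, `g = ∑ᵢ eᵢ yᵢ`, with `e` a fresh i.i.d. standard Gaussian sequence. -/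
def chain (c : ℝ) : Kernel (UnitH c) (UnitH c) where
  toFun y := gaussianSeq.map (fun e => stepU c e y)
  measurable' := by
    have h := (Measure.measurable_map _ (measurable_stepU c)).comp
      (Measurable.map_prodMk_left (α := UnitH c) (ν := gaussianSeq))
    convert h using 2 with y
    simp only [Function.comp]
    rw [Measure.map_map (measurable_stepU c) measurable_prodMk_left]
    rfl

/-- The invariant probability measures of the normalized chain on `H_{c,2}`. -/
def invariantMeasures (c : ℝ) : Set (Measure (UnitH c)) :=
  {μ | IsProbabilityMeasure μ ∧ Kernel.Invariant (chain c) μ}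

/-- The extremal invariant measures: the extreme points of the convex set of invariant
probability measures. -/
def extremalInvariantMeasures (c : ℝ) : Set (Measure (UnitH c)) :=
  (invariantMeasures c).extremePoints ℝ≥0∞

/-- The unnormalized recursion `X̂_{n+1} = (∑ᵢ ε_{n,i} X̂_{n,i}, X̂_n)` started from `x`. -/
def Xhat (ε : ℕ → ℕ → ℝ) (x : ℕ → ℝ) : ℕ → ℕ → ℝ
  | 0 => x
  | n + 1 => prepend (comb (ε n) (Xhat ε x n)) (Xhat ε x n)

/-- `λ_v = ½ ∫ μ_v(dy) E_ε log (1 + (∑ᵢ εᵢ yᵢ)²)`. -/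
def lyap {c : ℝ} (μ : Measure (UnitH c)) : ℝ :=
  1 / 2 * ∫ y, ∫ e, Real.log (1 + comb e y.1 ^ 2) ∂gaussianSeq ∂μ

end RandomFibonacci

end

/-!
The state of the chain has `ℓ₂` norm one, so, given the past, the innovation `gₙ = ∑ᵢ ε_{n,i} (Zₙ)ᵢ`
is a combination of fresh standard Gaussian variables with coefficients of norm one. It is therefore
a standard Gaussian variable whatever the past was (`map_comb_gaussianSeq`, by characteristic
functions; for `c > 0` the coefficients of a point of `H_{c,2}` are absolutely summable, which makes
the series converge). Hence, for every starting point, the innovations `g₀, g₁, …` are i.i.d.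
standard Gaussian variables (`map_innovation_noise`), and the chain is driven by one Gaussian
variable per step.

Growth rate: by induction `X̂ₙ = ∏_{k < n} (1 + g_k²)^{1/2} Zₙ`, so `log ‖X̂ₙ‖₂` is half the sum of
the i.i.d. integrable variables `log (1 + g_k²)`, `k < n` (`log_l2norm_Xhat`), and the strong law of
large numbers gives the limit. Its value `½ 𝔼 log (1 + g²)` is `λ_v`, since the inner expectation in
`λ_v` is the same for all `y` of norm one (`lyap_eq`).

Existence: unrolling the recursion into the infinite past gives the stationary state
`ξᵢ / ∏_{j ≤ i} (1 + ξⱼ²)^{1/2}` with `ξ₀, ξ₁, …` i.i.d. standard Gaussian variables, the most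
recent one first. A step of the chain puts a new innovation in front of `ξ`, which preserves the law
of `ξ` (`map_cons_prod_infinitePi`), so the law of this state is invariant
(`invariantMeasures_nonempty`). The squares of its coordinates telescope, and its weighted norm is
bounded by `∑ᵢ e^{ci} ∏_{j < i} (1 + ξⱼ²)⁻¹`, of expectation `∑ᵢ (e^c q)^i` with
`q = 𝔼[1 / (1 + ξ²)] < 1`; this is finite for `e^c q < 1`, that is, for all small `c`.
-/

namespace RandomFibonacci

/-! ### Products of copies of one probability measure along `ℕ` -/

section InfinitePi

variable {X : Type*} [MeasurableSpace X]

theorem eq_infinitePi_of_range (ν : Measure X) [IsProbabilityMeasure ν] {ρ : Measure (ℕ → X)}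
    (h : ∀ (n : ℕ) (t : ℕ → Set X), (∀ i, MeasurableSet (t i)) →
      ρ (Set.pi (Finset.range n) t) = ∏ i ∈ Finset.range n, ν (t i)) :
    ρ = Measure.infinitePi fun _ : ℕ => ν := by
  classical
  refine Measure.eq_infinitePi _ fun s t ht => ?_
  obtain ⟨n, hn⟩ := s.exists_nat_subset_range
  have hset : Set.pi (s : Set ℕ) t =
      Set.pi (Finset.range n : Set ℕ) fun i => if i ∈ s then t i else Set.univ := by
    ext x
    simp only [Set.mem_pi, Finset.mem_coe]
    refine ⟨fun hx i _ => ?_, fun hx i hi => ?_⟩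
    · split_ifs with his
      exacts [hx i his, Set.mem_univ _]
    · simpa [hi] using hx i (hn hi)
  rw [hset, h n _ fun i => by split_ifs; exacts [ht i, MeasurableSet.univ],
    ← Finset.prod_subset hn]
  · exact Finset.prod_congr rfl fun i hi => by simp [hi]
  · intro i _ hi
    simp [hi]

/-- Put a term in front of a sequence. -/
def cons (p : X × (ℕ → X)) : ℕ → X
  | 0 => p.1
  | i + 1 => p.2 i

@[fun_prop]
theorem measurable_cons : Measurable (cons (X := X)) := by
  refine measurable_pi_lambda _ fun i => ?_
  cases i with
  | zero => exact measurable_fst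
  | succ i => exact (measurable_pi_apply i).comp measurable_snd

theorem map_cons_prod_infinitePi (ν : Measure X) [IsProbabilityMeasure ν] :
    (ν.prod (Measure.infinitePi fun _ : ℕ => ν)).map cons = Measure.infinitePi fun _ : ℕ => ν := by
  refine eq_infinitePi_of_range ν fun n t ht => ?_
  rw [Measure.map_apply measurable_cons
    (MeasurableSet.pi (Finset.countable_toSet _) fun i _ => ht i)]
  cases n with
  | zero => simp
  | succ n =>
    have hset : cons ⁻¹' Set.pi (Finset.range (n + 1) : Set ℕ) t =
        t 0 ×ˢ Set.pi (Finset.range n : Set ℕ) fun i => t (i + 1) := by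
      ext ⟨a, x⟩
      simp only [Set.mem_preimage, Set.mem_pi, Finset.coe_range, Set.mem_Iio, Set.mem_prod]
      refine ⟨fun h => ⟨h 0 n.succ_pos, fun i hi => h (i + 1) (by omega)⟩, ?_⟩
      rintro ⟨h0, h1⟩ (_ | i) hi
      exacts [h0, h1 i (by omega)]
    rw [hset, Measure.prod_prod, Measure.infinitePi_pi _ fun i _ => ht (i + 1),
      Finset.prod_range_succ', mul_comm]

theorem ae_infinitePi_of_ae_ae_cons (ν : Measure X) [IsProbabilityMeasure ν] {s : Set (ℕ → X)}
    (hs : MeasurableSet s)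
    (h : ∀ᵐ a ∂ν, ∀ᵐ x ∂(Measure.infinitePi fun _ : ℕ => ν), cons (a, x) ∈ s) :
    ∀ᵐ x ∂(Measure.infinitePi fun _ : ℕ => ν), x ∈ s := by
  rw [← map_cons_prod_infinitePi ν]
  refine (ae_map_iff measurable_cons.aemeasurable hs).2 ?_
  exact (Measure.ae_prod_mem_iff_ae_ae_mem (measurable_cons hs)).2 h

theorem lintegral_prod_range_infinitePi (ν : Measure X) [IsProbabilityMeasure ν] {f : X → ℝ≥0∞}
    (hf : Measurable f) (n : ℕ) :
    ∫⁻ x, ∏ i ∈ Finset.range n, f (x i) ∂(Measure.infinitePi fun _ : ℕ => ν) =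
      (∫⁻ a, f a ∂ν) ^ n := by
  induction n with
  | zero => simp
  | succ n ih =>
    have ih' := congrArg (fun r => (∫⁻ a, f a ∂ν) * r) ih
    rw [pow_succ', ← map_cons_prod_infinitePi ν, lintegral_map (by fun_prop) measurable_cons]
    simp only [Finset.prod_range_succ', cons]
    rw [← lintegral_prod_mul hf.aemeasurable (Measurable.aemeasurable (by fun_prop))] at ih'
    simpa only [mul_comm] using ih'

end InfinitePi

/-! ### Linear combinations of i.i.d. standard Gaussian variables -/

theorem summable_abs_of_mem_H {c : ℝ} (hc : 0 < c) {y : ℕ → ℝ} (hy : y ∈ H c) :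
    Summable fun i => |y i| := by
  have hgeo : Summable fun i : ℕ => Real.exp (-c) ^ i :=
    summable_geometric_of_lt_one (Real.exp_pos _).le (Real.exp_lt_one_iff.2 (by linarith))
  refine Summable.of_nonneg_of_le (fun i => abs_nonneg _) (fun i => ?_) (hgeo.add hy.2)
  have h1 : Real.exp (-c) ^ i * Real.exp (c * i) = 1 := by
    rw [← Real.exp_nat_mul, ← Real.exp_add]
    simp [mul_comm]
  have h2 := Real.exp_pos (c * i)
  have h3 : 0 < Real.exp (-c) ^ i := by positivity
  -- `|y| ≤ a + b y²` as soon as `a b = 1`, by the inequality of arithmetic and geometric means.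
  nlinarith [sq_nonneg (Real.exp (-c) ^ i - |y i|), sq_abs (y i), abs_nonneg (y i),
    mul_nonneg h2.le (sq_nonneg (Real.exp (-c) ^ i - |y i|))]

theorem tsum_sq_eq_one {c : ℝ} (y : UnitH c) : ∑' i, y.1 i ^ 2 = 1 := by
  simpa [l2norm] using y.2.2

theorem measurableSet_summable {α : Type*} [MeasurableSpace α] {f : ℕ → α → ℝ}
    (hf : ∀ i, Measurable (f i)) : MeasurableSet {a | Summable fun i => f i a} := by
  have h : {a | Summable fun i => f i a} = {a | ∑' i, ‖f i a‖ₑ ≠ ∞} := by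
    ext a
    exact summable_norm_iff.symm.trans tsum_enorm_ne_top_iff_summable_norm.symm
  rw [h]
  have hm : Measurable fun a => ∑' i, ‖f i a‖ₑ := Measurable.tsum fun i => (hf i).enorm
  exact (hm (measurableSet_singleton ∞)).compl

theorem ae_summable_mul {y : ℕ → ℝ} (hy : Summable fun i => |y i|) :
    ∀ᵐ e ∂gaussianSeq, Summable fun i => e i * y i := by
  have hm : ∫⁻ x, ‖x‖ₑ ∂(gaussianReal 0 1) < ∞ :=
    ((memLp_id_gaussianReal 1).integrable (by simp)).2
  have hfin : ∫⁻ e, ∑' i, ‖e i * y i‖ₑ ∂gaussianSeq ≠ ∞ := by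
    have hterm : ∀ i, ∫⁻ e, ‖e i * y i‖ₑ ∂gaussianSeq =
        (∫⁻ x, ‖x‖ₑ ∂(gaussianReal 0 1)) * ‖y i‖ₑ := by
      intro i
      simp only [enorm_mul]
      rw [lintegral_mul_const _ (by fun_prop), gaussianSeq]
      conv_rhs => rw [← Measure.infinitePi_map_eval (fun _ : ℕ => gaussianReal 0 1) i]
      rw [lintegral_map (by fun_prop) (by fun_prop)]
    rw [lintegral_tsum fun i => Measurable.aemeasurable (by fun_prop)]
    simp only [hterm, ENNReal.tsum_mul_left]
    exact ENNReal.mul_ne_top hm.ne (tsum_enorm_ne_top_iff_summable_norm.2 hy)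
  have hmeas : Measurable fun e : ℕ → ℝ => ∑' i, ‖e i * y i‖ₑ :=
    Measurable.tsum fun i => by fun_prop
  filter_upwards [ae_lt_top hmeas hfin] with e he
  exact (tsum_enorm_ne_top_iff_summable_norm.1 he.ne).of_norm

theorem charFun_map_sum_gaussianSeq (y : ℕ → ℝ) (n : ℕ) (t : ℝ) :
    charFun (gaussianSeq.map fun e => ∑ i ∈ Finset.range n, e i * y i) t =
      Complex.exp (-(t ^ 2 / 2 * ∑ i ∈ Finset.range n, y i ^ 2 : ℝ)) := by
  have hind : iIndepFun (fun (i : ℕ) (e : ℕ → ℝ) => y i * e i) gaussianSeq :=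
    iIndepFun_infinitePi (X := fun i x => y i * x) fun i => by fun_prop
  simp only [mul_comm _ (y _)]
  rw [iIndepFun.charFun_map_fun_finsetSum_eq_prod
    (fun i _ => Measurable.aemeasurable (by fun_prop)) (hind.restrict _),
    Finset.prod_apply]
  have hterm : ∀ i, charFun (gaussianSeq.map fun e => y i * e i) t =
      Complex.exp (-(t ^ 2 / 2 * y i ^ 2 : ℝ)) := by
    intro i
    rw [charFun_map_mul_comp (Measurable.aemeasurable (by fun_prop)), gaussianSeq,
      Measure.infinitePi_map_eval (fun _ : ℕ => gaussianReal 0 1) i, charFun_gaussianReal]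
    congr 1
    push_cast
    ring
  simp only [hterm]
  rw [← Complex.exp_sum]
  congr 1
  push_cast
  rw [Finset.mul_sum, Finset.sum_neg_distrib]

/-- The combination of i.i.d. standard Gaussian variables with coefficients of `ℓ₂` norm one is
again a standard Gaussian variable. -/
theorem map_comb_gaussianSeq {c : ℝ} (hc : 0 < c) (y : UnitH c) :
    gaussianSeq.map (fun e => comb e y.1) = gaussianReal 0 1 := by
  have hmeas : Measurable fun e => comb e y.1 := (measurable_comb c).comp measurable_prodMk_left
  have hp : IsProbabilityMeasure (gaussianSeq.map fun e => comb e y.1) :=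
    Measure.isProbabilityMeasure_map hmeas.aemeasurable
  refine Measure.ext_of_charFun (funext fun t => ?_)
  have h1 : Tendsto (fun n : ℕ =>
      charFun (gaussianSeq.map fun e => ∑ i ∈ Finset.range n, e i * y.1 i) t) atTop
      (𝓝 (charFun (gaussianSeq.map fun e => comb e y.1) t)) := by
    have hmap : ∀ {f : (ℕ → ℝ) → ℝ}, Measurable f → charFun (gaussianSeq.map f) t =
        ∫ e, Complex.exp (t * f e * Complex.I) ∂gaussianSeq := by
      intro f hf
      rw [charFun_apply_real, integral_map hf.aemeasurable (by fun_prop)]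
    rw [hmap hmeas]
    simp_rw [fun n : ℕ => hmap (f := fun e => ∑ i ∈ Finset.range n, e i * y.1 i) (by fun_prop)]
    refine tendsto_integral_of_dominated_convergence (fun _ => 1)
      (fun n => Measurable.aestronglyMeasurable (by fun_prop))
      (integrable_const _) (fun n => ae_of_all _ fun e => ?_) ?_
    · exact_mod_cast (Complex.norm_exp_ofReal_mul_I _).le
    · filter_upwards [ae_summable_mul (summable_abs_of_mem_H hc y.2.1)] with e he
      have := he.hasSum.tendsto_sum_nat
      have hcont : Continuous fun x : ℝ => Complex.exp (t * x * Complex.I) := by fun_prop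
      exact (hcont.tendsto _).comp this
  -- It remains to see that the characteristic functions of the partial sums tend to `e^{-t²/2}`.
  refine tendsto_nhds_unique h1 ?_
  simp only [charFun_map_sum_gaussianSeq]
  have h2 : Tendsto (fun n : ℕ => ∑ i ∈ Finset.range n, y.1 i ^ 2) atTop (𝓝 1) := by
    have h := y.2.1.1.hasSum.tendsto_sum_nat
    rwa [tsum_sq_eq_one y] at h
  have hcont : Continuous fun x : ℝ => Complex.exp (-(t ^ 2 / 2 * x : ℝ)) := by fun_prop
  have hlim : charFun (gaussianReal 0 1) t = Complex.exp (-(t ^ 2 / 2 * 1 : ℝ)) := by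
    rw [charFun_gaussianReal]
    congr 1
    push_cast
    ring
  rw [hlim]
  exact (hcont.tendsto 1).comp h2

/-! ### The chain driven by one Gaussian variable per step -/

/-- The move `y ↦ (g, y) / (1 + g²)^{1/2}` of the state space for a given value of `g`. It is encoded
through `stepU` with the noise `e = g y`, for which `comb e y = g` because `‖y‖₂ = 1`. -/
noncomputable def advance (c : ℝ) (g : ℝ) (y : UnitH c) : UnitH c := stepU c (fun i => g * y.1 i) y

theorem comb_mul_self {c : ℝ} (g : ℝ) (y : UnitH c) : comb (fun i => g * y.1 i) y.1 = g := by
  have h : ∀ i, g * y.1 i * y.1 i = g * y.1 i ^ 2 := fun i => by ring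
  simp only [comb, h, tsum_mul_left, tsum_sq_eq_one, mul_one]

theorem advance_apply {c : ℝ} (g : ℝ) (y : UnitH c) (i : ℕ) :
    (advance c g y).1 i = prepend g y.1 i / √(1 + g ^ 2) := by
  change prepend (comb (fun i => g * y.1 i) y.1) y.1 i /
    √(1 + comb (fun i => g * y.1 i) y.1 ^ 2) = _
  rw [comb_mul_self]

theorem stepU_eq_advance {c : ℝ} (e : ℕ → ℝ) (y : UnitH c) :
    stepU c e y = advance c (comb e y.1) y :=
  Subtype.ext (funext fun i => (advance_apply _ y i).symm)

theorem measurable_advance (c : ℝ) (y : UnitH c) : Measurable fun g => advance c g y :=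
  (measurable_stepU c).comp (measurable_const.prodMk (by fun_prop))

theorem measurable_comb_right {c : ℝ} (y : UnitH c) : Measurable fun e => comb e y.1 :=
  (measurable_comb c).comp measurable_prodMk_left

theorem chain_apply {c : ℝ} (hc : 0 < c) (y : UnitH c) :
    chain c y = (gaussianReal 0 1).map fun g => advance c g y := by
  rw [← map_comb_gaussianSeq hc y,
    Measure.map_map (measurable_advance c y) (measurable_comb_right y)]
  change gaussianSeq.map _ = _
  congr 1
  exact funext fun e => stepU_eq_advance e y

/-! ### An explicit invariant measure -/

/-- The squared `ℓ₂` mass that the coordinates of index at least `n` carry in the stationary state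
built from the innovations `ξ₀, ξ₁, …` (the most recent one first). -/
noncomputable def tailMass (ξ : ℕ → ℝ) (n : ℕ) : ℝ := ∏ j ∈ Finset.range n, (1 + ξ j ^ 2)⁻¹

/-- The stationary state built from the innovations `ξ₀, ξ₁, …` (the most recent one first):
`ξᵢ / ∏_{j ≤ i} (1 + ξⱼ²)^{1/2}`. -/
noncomputable def stationary (ξ : ℕ → ℝ) (i : ℕ) : ℝ := ξ i * √(tailMass ξ (i + 1))

theorem tailMass_nonneg (ξ : ℕ → ℝ) (n : ℕ) : 0 ≤ tailMass ξ n :=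
  Finset.prod_nonneg fun _ _ => by positivity

theorem stationary_sq (ξ : ℕ → ℝ) (i : ℕ) :
    stationary ξ i ^ 2 = tailMass ξ i - tailMass ξ (i + 1) := by
  rw [stationary, mul_pow, Real.sq_sqrt (tailMass_nonneg _ _), tailMass, tailMass,
    Finset.prod_range_succ]
  have h : 1 + ξ i ^ 2 ≠ 0 := by positivity
  field_simp
  ring

theorem tailMass_cons (g : ℝ) (ξ : ℕ → ℝ) (n : ℕ) :
    tailMass (cons (g, ξ)) (n + 1) = tailMass ξ n * (1 + g ^ 2)⁻¹ :=
  Finset.prod_range_succ' _ n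

theorem stationary_cons (g : ℝ) (ξ : ℕ → ℝ) (i : ℕ) :
    stationary (cons (g, ξ)) i = prepend g (stationary ξ) i / √(1 + g ^ 2) := by
  rw [stationary, tailMass_cons, Real.sqrt_mul (tailMass_nonneg _ _), Real.sqrt_inv]
  cases i with
  | zero => simp [cons, prepend, tailMass, div_eq_mul_inv]
  | succ i => simp only [cons, prepend, stationary, div_eq_mul_inv, mul_assoc]

/-- A set of innovations from which `stationary` builds a point of `UnitH c`: the weighted series of
the tail masses, which dominates that of the squares `(stationary ξ i)²`, converges. -/
def regularSeqs (c : ℝ) : Set (ℕ → ℝ) := {ξ | Summable fun i : ℕ => Real.exp (c * i) * tailMass ξ i}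

@[fun_prop]
theorem measurable_tailMass (n : ℕ) : Measurable fun ξ => tailMass ξ n := by
  unfold tailMass
  fun_prop

theorem measurable_stationary : Measurable stationary :=
  measurable_pi_lambda _ fun i => (measurable_pi_apply i).mul (measurable_tailMass (i + 1)).sqrt

theorem measurableSet_regularSeqs (c : ℝ) : MeasurableSet (regularSeqs c) :=
  measurableSet_summable fun i => (measurable_tailMass i).const_mul _

theorem cons_mem_regularSeqs {c : ℝ} {ξ : ℕ → ℝ} (g : ℝ) (hξ : ξ ∈ regularSeqs c) :
    cons (g, ξ) ∈ regularSeqs c := by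
  refine (summable_nat_add_iff
    (f := fun i : ℕ => Real.exp (c * i) * tailMass (cons (g, ξ)) i) 1).1 ?_
  refine (Summable.mul_left (Real.exp c * (1 + g ^ 2)⁻¹) hξ).congr fun i => ?_
  rw [tailMass_cons, Nat.cast_add, Nat.cast_one, mul_add, mul_one, Real.exp_add]
  ring

theorem stationary_mem {c : ℝ} (hc : 0 < c) {ξ : ℕ → ℝ} (hξ : ξ ∈ regularSeqs c) :
    stationary ξ ∈ H c ∧ l2norm (stationary ξ) = 1 := by
  have hle : ∀ i, stationary ξ i ^ 2 ≤ tailMass ξ i := fun i => by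
    rw [stationary_sq]
    linarith [tailMass_nonneg ξ (i + 1)]
  have hexp : Summable fun i : ℕ => Real.exp (c * i) * stationary ξ i ^ 2 :=
    Summable.of_nonneg_of_le (fun i => by positivity)
      (fun i => mul_le_mul_of_nonneg_left (hle i) (Real.exp_pos _).le) hξ
  have hone : ∀ i : ℕ, 1 ≤ Real.exp (c * i) := fun i => Real.one_le_exp (by positivity)
  have hmass : Summable (tailMass ξ) :=
    Summable.of_nonneg_of_le (tailMass_nonneg ξ)
      (fun i => le_mul_of_one_le_left (tailMass_nonneg ξ i) (hone i)) hξ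
  -- The squares telescope, and the mass beyond `n` tends to zero.
  have hsum : HasSum (fun i => stationary ξ i ^ 2) 1 := by
    rw [hasSum_iff_tendsto_nat_of_nonneg fun i => sq_nonneg _]
    simp only [stationary_sq, Finset.sum_range_sub']
    simpa [tailMass] using hmass.tendsto_atTop_zero.const_sub (tailMass ξ 0)
  exact ⟨⟨hsum.summable, hexp⟩, by rw [l2norm, hsum.tsum_eq, Real.sqrt_one]⟩

theorem ae_mem_regularSeqs {c : ℝ}
    (hc : ENNReal.ofReal (Real.exp c) *
      ∫⁻ x, ENNReal.ofReal (1 + x ^ 2)⁻¹ ∂(gaussianReal 0 1) < 1) :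
    ∀ᵐ ξ ∂gaussianSeq, ξ ∈ regularSeqs c := by
  have hterm : ∀ (ξ : ℕ → ℝ) (i : ℕ), ‖Real.exp (c * i) * tailMass ξ i‖ₑ =
      ENNReal.ofReal (Real.exp c) ^ i *
        ∏ j ∈ Finset.range i, ENNReal.ofReal (1 + ξ j ^ 2)⁻¹ := by
    intro ξ i
    rw [Real.enorm_of_nonneg (mul_nonneg (Real.exp_pos _).le (tailMass_nonneg ξ i)),
      ENNReal.ofReal_mul (Real.exp_pos _).le, tailMass,
      ENNReal.ofReal_prod_of_nonneg fun _ _ => by positivity,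
      ← ENNReal.ofReal_pow (Real.exp_pos _).le, ← Real.exp_nat_mul, mul_comm c]
  have hmeas : ∀ i : ℕ, Measurable fun ξ : ℕ → ℝ => ‖Real.exp (c * i) * tailMass ξ i‖ₑ :=
    fun i => ((measurable_tailMass i).const_mul _).enorm
  have hfin : ∫⁻ ξ, ∑' i : ℕ, ‖Real.exp (c * i) * tailMass ξ i‖ₑ ∂gaussianSeq ≠ ∞ := by
    rw [lintegral_tsum fun i => (hmeas i).aemeasurable]
    have hint : ∀ i : ℕ, ∫⁻ ξ, ‖Real.exp (c * i) * tailMass ξ i‖ₑ ∂gaussianSeq =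
        (ENNReal.ofReal (Real.exp c) *
          ∫⁻ x, ENNReal.ofReal (1 + x ^ 2)⁻¹ ∂(gaussianReal 0 1)) ^ i := by
      intro i
      simp only [hterm]
      rw [lintegral_const_mul _ (by fun_prop), gaussianSeq,
        lintegral_prod_range_infinitePi _ (f := fun x : ℝ => ENNReal.ofReal (1 + x ^ 2)⁻¹)
          (by fun_prop), mul_pow]
    simp only [hint]
    rw [ENNReal.tsum_geometric]
    exact ENNReal.inv_ne_top.2 (tsub_pos_of_lt hc).ne'
  filter_upwards [ae_lt_top (Measurable.tsum hmeas) hfin] with ξ hξ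
  exact (tsum_enorm_ne_top_iff_summable_norm.1 hξ.ne).of_norm

theorem lintegral_inv_one_add_sq_lt_one :
    ∫⁻ x, ENNReal.ofReal (1 + x ^ 2)⁻¹ ∂(gaussianReal 0 1) < 1 := by
  have hna : NullSingletonClass (gaussianReal 0 1) :=
    nullSingletonClass_gaussianReal one_ne_zero
  have hle : ∫⁻ x, ENNReal.ofReal (1 + x ^ 2)⁻¹ ∂(gaussianReal 0 1) ≤ 1 := by
    refine (lintegral_mono (g := fun _ => 1) fun x => ?_).trans (by simp)
    exact ENNReal.ofReal_le_one.2 (inv_le_one_of_one_le₀ (by nlinarith [sq_nonneg x]))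
  refine (lintegral_strict_mono (g := fun _ => 1) (NeZero.ne _) (by fun_prop)
    (hle.trans_lt ENNReal.one_lt_top).ne ?_).trans_le (by simp)
  filter_upwards [compl_mem_ae_iff.2 (measure_singleton (0 : ℝ))] with x hx
  have hx' : 0 < x ^ 2 := by
    have : x ≠ 0 := hx
    positivity
  exact ENNReal.ofReal_lt_one.2 (inv_lt_one_of_one_lt₀ (by linarith))

/-- The law of `stationary ξ`, for i.i.d. standard Gaussian innovations `ξ`, is invariant: a step of
the chain puts one more innovation in front of `ξ`. -/
theorem invariantMeasures_nonempty {c : ℝ} (hc : 0 < c)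
    (hreg : ∀ᵐ ξ ∂gaussianSeq, ξ ∈ regularSeqs c) : (invariantMeasures c).Nonempty := by
  classical
  obtain ⟨ξ₀, h₀⟩ := hreg.exists
  -- The value outside `regularSeqs c`, a null set, is immaterial.
  let Φ : (ℕ → ℝ) → UnitH c := fun ξ =>
    if h : ξ ∈ regularSeqs c then ⟨stationary ξ, stationary_mem hc h⟩
    else ⟨stationary ξ₀, stationary_mem hc h₀⟩
  have hΦ : ∀ {ξ}, ξ ∈ regularSeqs c → (Φ ξ).1 = stationary ξ := fun h => by simp [Φ, h]
  have hΦm : Measurable Φ := by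
    have hval : Measurable fun ξ => (Φ ξ).1 := by
      have : (fun ξ => (Φ ξ).1) =
          fun ξ => if ξ ∈ regularSeqs c then stationary ξ else stationary ξ₀ := by
        funext ξ
        by_cases h : ξ ∈ regularSeqs c <;> simp [Φ, h]
      rw [this]
      exact Measurable.ite (measurableSet_regularSeqs c) measurable_stationary measurable_const
    exact Measurable.subtype_mk hval
  have hstep : ∀ {ξ}, ξ ∈ regularSeqs c → ∀ g, advance c g (Φ ξ) = Φ (cons (g, ξ)) := by
    intro ξ h g
    refine Subtype.ext (funext fun i => ?_)
    rw [advance_apply, hΦ h, hΦ (cons_mem_regularSeqs g h), stationary_cons]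
  refine ⟨gaussianSeq.map Φ, Measure.isProbabilityMeasure_map hΦm.aemeasurable, ?_⟩
  refine Measure.ext fun s hs => ?_
  have hcons : MeasurableSet (cons ⁻¹' (Φ ⁻¹' s) : Set (ℝ × (ℕ → ℝ))) := measurable_cons (hΦm hs)
  calc (gaussianSeq.map Φ).bind (chain c) s
      = ∫⁻ y, chain c y s ∂(gaussianSeq.map Φ) :=
        Measure.bind_apply hs (chain c).measurable.aemeasurable
    _ = ∫⁻ ξ, chain c (Φ ξ) s ∂gaussianSeq := lintegral_map ((chain c).measurable_coe hs) hΦm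
    _ = ∫⁻ ξ, gaussianReal 0 1 ((fun g => (g, ξ)) ⁻¹' (cons ⁻¹' (Φ ⁻¹' s))) ∂gaussianSeq := by
        refine lintegral_congr_ae ?_
        filter_upwards [hreg] with ξ h
        rw [chain_apply hc, Measure.map_apply (measurable_advance c _) hs]
        congr 1
        ext g
        simp only [Set.mem_preimage, hstep h]
    _ = ((gaussianReal 0 1).prod gaussianSeq) (cons ⁻¹' (Φ ⁻¹' s)) :=
        (Measure.prod_apply_symm hcons).symm
    _ = gaussianSeq.map Φ s := by
        rw [← Measure.map_apply measurable_cons (hΦm hs), gaussianSeq, map_cons_prod_infinitePi,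
          Measure.map_apply hΦm hs]

/-- The threshold is `-log r` for some `r` with `𝔼[1 / (1 + g²)] < r < 1`, so that `c < -log r` gives
`e^c 𝔼[1 / (1 + g²)] < 1` and the series defining `regularSeqs c` has finite expectation. -/
theorem exists_invariantMeasures_nonempty :
    ∃ c₀ : ℝ, 0 < c₀ ∧ ∀ c : ℝ, 0 < c → c < c₀ → (invariantMeasures c).Nonempty := by
  obtain ⟨r, hr, hr1⟩ := exists_between lintegral_inv_one_add_sq_lt_one
  have hr0 : r ≠ 0 := (bot_le.trans_lt hr).ne'
  have hrtop : r ≠ ∞ := (hr1.trans ENNReal.one_lt_top).ne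
  have hrpos : 0 < r.toReal := ENNReal.toReal_pos hr0 hrtop
  have hrlt : r.toReal < 1 := by
    rw [← ENNReal.toReal_one]
    exact (ENNReal.toReal_lt_toReal hrtop ENNReal.one_ne_top).2 hr1
  refine ⟨-Real.log r.toReal, neg_pos.2 (Real.log_neg hrpos hrlt), fun c hc hlt => ?_⟩
  refine invariantMeasures_nonempty hc (ae_mem_regularSeqs ?_)
  have hexp : Real.exp c * r.toReal < 1 := by
    have h := Real.exp_lt_one_iff.2 (show c + Real.log r.toReal < 0 by linarith)
    rwa [Real.exp_add, Real.exp_log hrpos] at h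
  calc ENNReal.ofReal (Real.exp c) * ∫⁻ x, ENNReal.ofReal (1 + x ^ 2)⁻¹ ∂(gaussianReal 0 1)
      ≤ ENNReal.ofReal (Real.exp c) * r := mul_le_mul_right hr.le _
    _ = ENNReal.ofReal (Real.exp c * r.toReal) := by
        rw [ENNReal.ofReal_mul (Real.exp_pos _).le, ENNReal.ofReal_toReal hrtop]
    _ < 1 := ENNReal.ofReal_lt_one.2 hexp

/-! ### The innovations along the chain -/

/-- The normalized chain `Z₀ = y`, `Z_{n+1} = stepU c (ε n) Zₙ` driven by the noise `ε`. -/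
noncomputable def orbit (c : ℝ) (ε : ℕ → ℕ → ℝ) (y : UnitH c) : ℕ → UnitH c
  | 0 => y
  | n + 1 => stepU c (ε n) (orbit c ε y n)

/-- The innovation `gₙ = ∑ᵢ ε_{n,i} (Zₙ)ᵢ` of the normalized chain. -/
noncomputable def innovation (c : ℝ) (ε : ℕ → ℕ → ℝ) (y : UnitH c) (n : ℕ) : ℝ :=
  comb (ε n) (orbit c ε y n).1

/-- The law of the noise `(ε_{n,i})`, as a sequence indexed by the time `n`. -/
noncomputable def noise : Measure (ℕ → ℕ → ℝ) := Measure.infinitePi fun _ : ℕ => gaussianSeq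

instance : IsProbabilityMeasure noise := by
  unfold noise; infer_instance

theorem orbit_cons {c : ℝ} (e : ℕ → ℝ) (ε : ℕ → ℕ → ℝ) (y : UnitH c) (n : ℕ) :
    orbit c (cons (e, ε)) y (n + 1) = orbit c ε (stepU c e y) n := by
  induction n with
  | zero => rfl
  | succ n ih => rw [orbit, ih]; rfl

theorem innovation_cons {c : ℝ} (e : ℕ → ℝ) (ε : ℕ → ℕ → ℝ) (y : UnitH c) (n : ℕ) :
    innovation c (cons (e, ε)) y (n + 1) = innovation c ε (stepU c e y) n := by
  rw [innovation, orbit_cons]; rfl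

theorem measurable_orbit (c : ℝ) (n : ℕ) :
    Measurable fun p : UnitH c × (ℕ → ℕ → ℝ) => orbit c p.2 p.1 n := by
  induction n with
  | zero => exact measurable_fst
  | succ n ih => exact (measurable_stepU c).comp (ih.prodMk (by fun_prop))

theorem measurable_innovation (c : ℝ) (n : ℕ) :
    Measurable fun p : UnitH c × (ℕ → ℕ → ℝ) => innovation c p.2 p.1 n :=
  (measurable_comb c).comp ((measurable_orbit c n).prodMk (by fun_prop))

theorem Xhat_eq_prod_mul_orbit {c : ℝ} (ε : ℕ → ℕ → ℝ) (y : UnitH c) (n i : ℕ) :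
    Xhat ε y.1 n i =
      (∏ k ∈ Finset.range n, √(1 + innovation c ε y k ^ 2)) * (orbit c ε y n).1 i := by
  induction n generalizing i with
  | zero => simp [Xhat, orbit]
  | succ n ih =>
    have hpos : √(1 + innovation c ε y n ^ 2) ≠ 0 := (Real.sqrt_pos.2 (by positivity)).ne'
    have hcomb : comb (ε n) (Xhat ε y.1 n) =
        (∏ k ∈ Finset.range n, √(1 + innovation c ε y k ^ 2)) * innovation c ε y n := by
      simp only [comb, ih, innovation, ← tsum_mul_left]
      exact tsum_congr fun i => by ring
    have hval : (orbit c ε y (n + 1)).1 i =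
        prepend (innovation c ε y n) (orbit c ε y n).1 i / √(1 + innovation c ε y n ^ 2) := rfl
    rw [hval, Finset.prod_range_succ, mul_assoc, mul_div_cancel₀ _ hpos]
    cases i with
    | zero => exact hcomb
    | succ i => exact ih i

theorem log_l2norm_Xhat {c : ℝ} (ε : ℕ → ℕ → ℝ) (y : UnitH c) (n : ℕ) :
    Real.log (l2norm (Xhat ε y.1 n)) =
      1 / 2 * ∑ k ∈ Finset.range n, Real.log (1 + innovation c ε y k ^ 2) := by
  have hnonneg : 0 ≤ ∏ k ∈ Finset.range n, √(1 + innovation c ε y k ^ 2) :=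
    Finset.prod_nonneg fun _ _ => Real.sqrt_nonneg _
  have hnorm : l2norm (Xhat ε y.1 n) = ∏ k ∈ Finset.range n, √(1 + innovation c ε y k ^ 2) := by
    simp only [l2norm, Xhat_eq_prod_mul_orbit, mul_pow, tsum_mul_left, tsum_sq_eq_one, mul_one]
    exact Real.sqrt_sq hnonneg
  rw [hnorm, Real.log_prod fun k _ => (Real.sqrt_pos.2 (by positivity)).ne', Finset.mul_sum]
  refine Finset.sum_congr rfl fun k _ => ?_
  rw [Real.log_sqrt (by positivity)]
  ring

/-- From every starting point, the innovations are i.i.d. standard Gaussian variables: given the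
past, `gₙ` is a combination of fresh Gaussian variables whose coefficients have `ℓ₂` norm one. -/
theorem map_innovation_noise {c : ℝ} (hc : 0 < c) (y : UnitH c) :
    noise.map (fun ε => innovation c ε y) = gaussianSeq := by
  have hmeas : ∀ y : UnitH c, Measurable fun ε => innovation c ε y := fun y =>
    measurable_pi_lambda _ fun n => (measurable_innovation c n).comp measurable_prodMk_left
  refine eq_infinitePi_of_range _ fun n t ht => ?_
  rw [Measure.map_apply (hmeas y) (MeasurableSet.pi (Finset.countable_toSet _) fun i _ => ht i)]
  induction n generalizing y t with
  | zero => simp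
  | succ n ih =>
    let s : UnitH c → Set (ℕ → ℕ → ℝ) := fun y =>
      (fun ε => innovation c ε y) ⁻¹' Set.pi (Finset.range n : Set ℕ) fun i => t (i + 1)
    have hpi : MeasurableSet (Set.pi (Finset.range (n + 1) : Set ℕ) t) :=
      MeasurableSet.pi (Finset.countable_toSet _) fun i _ => ht i
    have hcomb : MeasurableSet {e | comb e y.1 ∈ t 0} := measurable_comb_right y (ht 0)
    -- Condition on the noise `e` of the first step and restart the chain from `stepU c e y`.
    have hslice : ∀ e, Prod.mk e ⁻¹' (cons ⁻¹' ((fun ε => innovation c ε y) ⁻¹'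
        Set.pi (Finset.range (n + 1) : Set ℕ) t)) =
          {ε | comb e y.1 ∈ t 0} ∩ s (stepU c e y) := by
      intro e
      ext ε
      simp only [s, Set.mem_preimage, Set.mem_pi, Finset.coe_range, Set.mem_Iio, Set.mem_inter_iff,
        Set.mem_ofPred_eq]
      constructor
      · intro h
        refine ⟨h 0 n.succ_pos, fun i hi => ?_⟩
        rw [← innovation_cons]
        exact h (i + 1) (by omega)
      · rintro ⟨h0, h1⟩ (_ | i) hi
        · exact h0
        · rw [innovation_cons]
          exact h1 i (by omega)
    have hmeasure : ∀ e, noise ({ε : ℕ → ℕ → ℝ | comb e y.1 ∈ t 0} ∩ s (stepU c e y)) =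
        {e | comb e y.1 ∈ t 0}.indicator
          (fun _ => ∏ i ∈ Finset.range n, gaussianReal 0 1 (t (i + 1))) e := by
      intro e
      by_cases h : comb e y.1 ∈ t 0
      · simpa [h, s] using ih (stepU c e y) (fun i => t (i + 1)) fun i => ht (i + 1)
      · simp [h]
    rw [noise, ← map_cons_prod_infinitePi, Measure.map_apply measurable_cons (hmeas y hpi),
      Measure.prod_apply (measurable_cons (hmeas y hpi))]
    simp only [hslice]
    change ∫⁻ e, noise _ ∂gaussianSeq = _
    simp only [hmeasure]
    rw [lintegral_indicator_const hcomb, Finset.prod_range_succ', ← map_comb_gaussianSeq hc y,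
      Measure.map_apply (measurable_comb_right y) (ht 0)]
    rfl

theorem ae_summable_mul_orbit {c : ℝ} (hc : 0 < c) (y : UnitH c) (n : ℕ) :
    ∀ᵐ ε ∂noise, Summable fun i => ε n i * (orbit c ε y n).1 i := by
  have hmeas : ∀ (y : UnitH c) (n : ℕ),
      MeasurableSet {ε : ℕ → ℕ → ℝ | Summable fun i => ε n i * (orbit c ε y n).1 i} :=
    fun y n => measurableSet_summable fun i => Measurable.mul (by fun_prop)
      ((measurable_pi_apply i).comp (measurable_subtype_coe.comp
        ((measurable_orbit c n).comp measurable_prodMk_left)))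
  induction n generalizing y with
  | zero =>
    refine ae_infinitePi_of_ae_ae_cons gaussianSeq (hmeas y 0) ?_
    filter_upwards [ae_summable_mul (summable_abs_of_mem_H hc y.2.1)] with e he
    exact ae_of_all _ fun ε => he
  | succ n ih =>
    refine ae_infinitePi_of_ae_ae_cons gaussianSeq (hmeas y (n + 1)) (ae_of_all _ fun e => ?_)
    filter_upwards [ih (stepU c e y)] with ε hε
    change Summable fun i => ε n i * (orbit c (cons (e, ε)) y (n + 1)).1 i
    simpa only [orbit_cons] using hε

/-! ### The law of large numbers for the innovations -/

theorem integrable_log_one_add_sq :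
    Integrable (fun x : ℝ => Real.log (1 + x ^ 2)) (gaussianReal 0 1) := by
  have hsq : Integrable (fun x : ℝ => x ^ 2) (gaussianReal 0 1) :=
    (memLp_id_gaussianReal 2).integrable_sq
  refine hsq.mono' (Measurable.aestronglyMeasurable (by fun_prop)) (ae_of_all _ fun x => ?_)
  have h0 : 0 ≤ Real.log (1 + x ^ 2) := Real.log_nonneg (by nlinarith [sq_nonneg x])
  rw [Real.norm_of_nonneg h0]
  linarith [Real.log_le_sub_one_of_pos (show 0 < 1 + x ^ 2 by positivity)]

theorem ae_tendsto_average_log :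
    ∀ᵐ ξ ∂gaussianSeq, Tendsto
      (fun n : ℕ => (∑ k ∈ Finset.range n, Real.log (1 + ξ k ^ 2)) / n) atTop
      (𝓝 (∫ x, Real.log (1 + x ^ 2) ∂(gaussianReal 0 1))) := by
  have heval : ∀ k, MeasurePreserving (fun ξ : ℕ → ℝ => ξ k) gaussianSeq (gaussianReal 0 1) :=
    fun k => measurePreserving_eval_infinitePi (fun _ : ℕ => gaussianReal 0 1) k
  have hlog : Measurable fun x : ℝ => Real.log (1 + x ^ 2) := by fun_prop
  have hind : iIndepFun (fun (k : ℕ) (ξ : ℕ → ℝ) => Real.log (1 + ξ k ^ 2)) gaussianSeq :=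
    iIndepFun_infinitePi (X := fun _ x => Real.log (1 + x ^ 2)) fun _ => hlog
  have h := strong_law_ae_real (fun (k : ℕ) (ξ : ℕ → ℝ) => Real.log (1 + ξ k ^ 2))
    ((heval 0).integrable_comp_of_integrable integrable_log_one_add_sq)
    (fun i j hij => hind.indepFun hij)
    (fun i => IdentDistrib.comp (u := fun x : ℝ => Real.log (1 + x ^ 2))
      ⟨(heval i).aemeasurable, (heval 0).aemeasurable, by rw [(heval i).map_eq, (heval 0).map_eq]⟩
      hlog)
  rwa [← (heval 0).map_eq, integral_map (heval 0).aemeasurable hlog.aestronglyMeasurable]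

theorem measurePreserving_comb {c : ℝ} (hc : 0 < c) (μ : Measure (UnitH c))
    [IsProbabilityMeasure μ] :
    MeasurePreserving (fun p : UnitH c × (ℕ → ℝ) => comb p.2 p.1.1) (μ.prod gaussianSeq)
      (gaussianReal 0 1) := by
  refine ⟨measurable_comb c, Measure.ext fun s hs => ?_⟩
  rw [Measure.map_apply (measurable_comb c) hs, Measure.prod_apply (measurable_comb c hs)]
  have h : ∀ y : UnitH c, gaussianSeq (Prod.mk y ⁻¹' ((fun p : UnitH c × (ℕ → ℝ) =>
      comb p.2 p.1.1) ⁻¹' s)) = gaussianReal 0 1 s := fun y => by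
    rw [← map_comb_gaussianSeq hc y, Measure.map_apply (measurable_comb_right y) hs]
    rfl
  simp [h]

/-- The Lyapunov exponent does not depend on the law `μ` of the starting point. -/
theorem lyap_eq {c : ℝ} (hc : 0 < c) (μ : Measure (UnitH c)) [IsProbabilityMeasure μ] :
    lyap μ = 1 / 2 * ∫ x, Real.log (1 + x ^ 2) ∂(gaussianReal 0 1) := by
  have h : ∀ y : UnitH c, ∫ e, Real.log (1 + comb e y.1 ^ 2) ∂gaussianSeq =
      ∫ x, Real.log (1 + x ^ 2) ∂(gaussianReal 0 1) := fun y => by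
    rw [← map_comb_gaussianSeq hc y, integral_map (measurable_comb_right y).aemeasurable
      (Measurable.aestronglyMeasurable (by fun_prop))]
  simp [lyap, h]

theorem ae_summable_and_tendsto {c : ℝ} (hc : 0 < c) (μ : Measure (UnitH c))
    [IsProbabilityMeasure μ] :
    ∀ᵐ p ∂(μ.prod noise),
      (∀ n, Summable fun i => p.2 n i * Xhat p.2 p.1.1 n i) ∧
      Tendsto (fun n : ℕ => 1 / (n : ℝ) * Real.log (l2norm (Xhat p.2 p.1.1 n))) atTop
        (𝓝 (lyap μ)) := by
  let L : ℝ := ∫ x, Real.log (1 + x ^ 2) ∂(gaussianReal 0 1)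
  let S : Set (UnitH c × (ℕ → ℕ → ℝ)) :=
    {p | ∀ n, Summable fun i => p.2 n i * (orbit c p.2 p.1 n).1 i} ∩
    {p | Tendsto (fun n : ℕ =>
      (∑ k ∈ Finset.range n, Real.log (1 + innovation c p.2 p.1 k ^ 2)) / n) atTop (𝓝 L)}
  have hinn := measurable_innovation c
  have hS : MeasurableSet S := by
    refine MeasurableSet.inter ?_ (measurableSet_tendsto _ fun n => by fun_prop)
    rw [Set.ofPred_forall]
    exact MeasurableSet.iInter fun n => measurableSet_summable fun i => Measurable.mul
      (by fun_prop) ((measurable_pi_apply i).comp (measurable_subtype_coe.comp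
        (measurable_orbit c n)))
  have hae : ∀ᵐ p ∂(μ.prod noise), p ∈ S := by
    refine (Measure.ae_prod_mem_iff_ae_ae_mem hS).2 (ae_of_all _ fun y => ?_)
    have hlln := ae_tendsto_average_log
    rw [← map_innovation_noise hc y] at hlln
    filter_upwards [ae_all_iff.2 (ae_summable_mul_orbit hc y),
      ae_of_ae_map (measurable_pi_lambda _ fun n =>
        (hinn n).comp measurable_prodMk_left).aemeasurable hlln] with ε h1 h2
    exact ⟨h1, h2⟩
  filter_upwards [hae] with p hp
  refine ⟨fun n => ?_, ?_⟩
  · simp only [Xhat_eq_prod_mul_orbit]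
    exact ((hp.1 n).mul_left _).congr fun i => by ring
  · rw [lyap_eq hc μ]
    refine (hp.2.const_mul (1 / 2)).congr fun n => ?_
    rw [log_l2norm_Xhat]
    ring

theorem hasLaw_noise {Ω : Type*} [MeasurableSpace Ω] {P : Measure Ω} [IsProbabilityMeasure P]
    {ε : ℕ → ℕ → Ω → ℝ} (hε : ∀ n i, HasLaw (ε n i) (gaussianReal 0 1) P)
    (hind : iIndepFun (fun p : ℕ × ℕ => ε p.1 p.2) P) :
    HasLaw (fun ω (p : ℕ × ℕ) => ε p.1 p.2 ω)
      (Measure.infinitePi fun _ : ℕ × ℕ => gaussianReal 0 1) P :=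
  iIndepFun.hasLaw_infinitePi (fun p => hε p.1 p.2) hind
    (aemeasurable_pi_iff.2 fun p => (hε p.1 p.2).aemeasurable)

end RandomFibonacci

theorem mainTheorem7 :
    ∃ c₀ : ℝ, 0 < c₀ ∧ ∀ c : ℝ, 0 < c →
      -- (i) existence of an invariant measure on `H_{c,2}`, for all small `c > 0`
      (c < c₀ → (RandomFibonacci.invariantMeasures c).Nonempty) ∧
      -- (ii) growth rate when started from an extremal invariant measure
      ∀ μ ∈ RandomFibonacci.extremalInvariantMeasures c,
        Integrable (fun p : RandomFibonacci.UnitH c × (ℕ → ℝ) =>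
          Real.log (1 + RandomFibonacci.comb p.2 p.1.1 ^ 2))
          (μ.prod RandomFibonacci.gaussianSeq) ∧
        ∀ (Ω : Type*) [MeasurableSpace Ω] (P : Measure Ω) [IsProbabilityMeasure P]
          (ε : ℕ → ℕ → Ω → ℝ) (X₀ : Ω → RandomFibonacci.UnitH c),
          (∀ n i, HasLaw (ε n i) (gaussianReal 0 1) P) →
          iIndepFun (fun p : ℕ × ℕ => ε p.1 p.2) P →
          HasLaw X₀ μ P →
          IndepFun X₀ (fun ω (p : ℕ × ℕ) => ε p.1 p.2 ω) P →
          ∀ᵐ ω ∂P,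
            (∀ n, Summable (fun i =>
              ε n i ω * RandomFibonacci.Xhat (fun m j => ε m j ω) (X₀ ω).1 n i)) ∧
            Tendsto (fun n : ℕ => 1 / (n : ℝ) *
                Real.log (RandomFibonacci.l2norm
                  (RandomFibonacci.Xhat (fun m j => ε m j ω) (X₀ ω).1 n)))
              atTop (𝓝 (RandomFibonacci.lyap μ)) := by
  obtain ⟨c₀, hc₀, hex⟩ := RandomFibonacci.exists_invariantMeasures_nonempty
  refine ⟨c₀, hc₀, fun c hc => ⟨hex c hc, fun μ hμ => ?_⟩⟩
  have hprob : IsProbabilityMeasure μ := hμ.1.1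
  refine ⟨(RandomFibonacci.measurePreserving_comb hc μ).integrable_comp_of_integrable
    RandomFibonacci.integrable_log_one_add_sq, fun Ω _ P _ ε X₀ hε hind hX₀ hX₀ε => ?_⟩
  have hcurry : MeasurePreserving (MeasurableEquiv.curry ℕ ℕ ℝ)
      (Measure.infinitePi fun _ : ℕ × ℕ => gaussianReal 0 1) RandomFibonacci.noise :=
    ⟨MeasurableEquiv.measurable _, Measure.infinitePi_map_curry fun _ _ => gaussianReal 0 1⟩
  have hlaw : HasLaw (fun ω => (X₀ ω, fun m j => ε m j ω)) (μ.prod RandomFibonacci.noise) P :=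
    IndepFun.hasLaw_prod hX₀ (hcurry.comp_hasLaw (RandomFibonacci.hasLaw_noise hε hind))
      (hX₀ε.comp measurable_id hcurry.measurable)
  have hae := RandomFibonacci.ae_summable_and_tendsto hc μ
  rw [← hlaw.map_eq] at hae
  exact ae_of_ae_map hlaw.aemeasurable hae
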